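/- Work in the universe of hypersets: pointed directed graphs (with sets of nodes of a fixed size level), in which terminal nodes may carry labels from a given class of urelements, taken up to bisimilarity; this is the standard model of set theory with the anti-foundation axiom, with urelements allowed. Let $\mathbf{AFA}$ be the category whose objects are the hypersets (urelements are not objects) and whose morphisms $A\to B$ are the total maps from the elements of $A$ to the elements of $B$. **(1)** $\mathbf{AFA}$ is cartesian closed in the usual way: $\mathbf 1=\{\emptyset\}$ is a terminal object; the product of $A$ and $B$ is the set $A\times B$ of Kuratowski pairs $(x,y)$, $x\in A$, $y\in B$, with the coordinate projections; the exponential $B^A$ is the set of all total functions from $A$ to $B$ (as sets of pairs), with evaluation $(x,f)\mapsto f(x)$. **(2)** Lawvere's lemma holds in $\mathbf{AFA}$: if $g\colon A\to Y^A$ is weakly point surjective, i.e. for every $p\colon A\to Y$ there is $x\colon\mathbf 1\to A$ with $p\circ y=\hat g\circ\langle x,y\rangle$ for all $y\colon\mathbf 1\to A$, where $\hat g\colon A\times A\to Y$, $\hat g(x,y)=g(x)(y)$, then $Y$ has the fixed-point property: for every $f\colon Y\to Y$ there is $y\colon\mathbf 1\to Y$ with $f\circ y=y$. A *non-well-founded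 (NWF) belief model* $M$ consists of a nonempty hyperset $W$ of states, a valuation $V$ assigning to each propositional variable a subset of $W$, and type spaces $U^a,U^b\subseteq W$ of two players with $U^a\cup U^b=W$ (disjointness is not needed). For $i,j\in\{a,b\}$ let $D^{ij}=\{w\in U^i:\ \forall v\in U^j\ (v\in w\to w\notin v)\}$. Modal formulas are built from propositional variables, $\top$, propositions $\mathbf U^i$ and $\mathbf D^{ij}$ true exactly on $U^i$ and $D^{ij}$, by $\neg$, $\wedge$, $\Box$, $\Box^{ij}$ and $\heartsuit^{ij}$. The quantifiers below range over $v\in W$: $$w\models\Box\varphi \iff \forall v\,(v\in w\to v\models\varphi),$$ $$w\models\Box^{ij}\varphi \iff w\in U^i\ \text{and}\ \forall v\,\big((v\in w\wedge v\in U^j)\to v\models\varphi\big),$$ $$w\models\heartsuit^{ij}\varphi \iff w\in U^i\ \text{and}\ \forall v\,\big((v\in w\wedge v\in U^j)\leftrightarrow v\models\varphi\big),$$ and $\Diamond^{ij}=\neg\Box^{ij}\neg$. **(3)** The Brandenburger–Keisler (BK) sentence $\Box^{ij}\heartsuit^{ji}\mathbf D^{ij}\wedge\Diamond^{ij}\top$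 ("Ann believes that Bob assumes that Ann believes that Bob's assumption is wrong", where Ann considers some state of Bob possible) is impossible: for $\{i,j\}=\{a,b\}$ it holds at no state of any NWF belief model. **(4)** No NWF belief model is complete. Say that $x\in U^i$ *assumes* $P\subseteq U^j$ if $x\cap U^j=P$, and that $M$ is *assumption complete* for a set $\Pi$ of subsets of $W$ if every $P\in\Pi$ with $P\subseteq U^b$ is assumed by some $x\in U^a$ and every $P\in\Pi$ with $P\subseteq U^a$ is assumed by some $y\in U^b$. Then no NWF belief model is assumption complete for the set of its subsets defined by modal formulas, nor for the set of its subsets first-order definable (without parameters) in $(W,\in,U^a,U^b)$. -/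

import Mathlib

universe u v w

open CategoryTheory MonoidalCategory CartesianMonoidalCategory

/-! ## Hypersets

The standard graph model of set theory with the anti-foundation axiom: a hyperset is a pointed
directed graph up to bisimilarity.  Urelements from an arbitrary type `𝒜` are allowed (take `𝒜`
empty for pure hypersets). -/

/-- A pointed directed graph. An arrow `edge p q` means that `q` is to be a member of `p`. A node
`p` with `atom p = some a` stands for the urelement `a` and has no members; all other nodes stand
for sets. -/
structure PointedGraph (𝒜 : Type v) : Type (max (u + 1) v) where
  Node : Type u
  edge : Node → Node → Prop
  atom : Node → Option 𝒜
  leaf : ∀ p q, edge p q → atom p = none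
  root : Node

namespace PointedGraph

variable {𝒜 : Type v}

/-- The same graph with another distinguished node. -/
def at' (G : PointedGraph.{u, v} 𝒜) (p : G.Node) : PointedGraph.{u, v} 𝒜 := { G with root := p }

structure IsBisimulation (G H : PointedGraph.{u, v} 𝒜) (R : G.Node → H.Node → Prop) : Prop where
  atom : ∀ p q, R p q → G.atom p = H.atom q
  forth : ∀ p q, R p q → ∀ p', G.edge p p' → ∃ q', H.edge q q' ∧ R p' q'
  back : ∀ p q, R p q → ∀ q', H.edge q q' → ∃ p', G.edge p p' ∧ R p' q'

def Bisimilar (G H : PointedGraph.{u, v} 𝒜) : Prop :=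
  ∃ R, IsBisimulation G H R ∧ R G.root H.root

theorem Bisimilar.refl (G : PointedGraph.{u, v} 𝒜) : Bisimilar G G :=
  ⟨Eq, ⟨by rintro p _ rfl; rfl, by rintro p _ rfl p' h; exact ⟨p', h, rfl⟩,
    by rintro p _ rfl p' h; exact ⟨p', h, rfl⟩⟩, rfl⟩

theorem Bisimilar.symm {G H : PointedGraph.{u, v} 𝒜} : Bisimilar G H → Bisimilar H G := by
  rintro ⟨R, hR, h⟩
  exact ⟨fun q p => R p q, ⟨fun p q h => (hR.atom q p h).symm, fun p q h => hR.back q p h,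
    fun p q h => hR.forth q p h⟩, h⟩

theorem Bisimilar.trans {G H K : PointedGraph.{u, v} 𝒜} :
    Bisimilar G H → Bisimilar H K → Bisimilar G K := by
  rintro ⟨R, hR, h⟩ ⟨S, hS, k⟩
  refine ⟨fun p r => ∃ q, R p q ∧ S q r, ⟨?_, ?_, ?_⟩, _, h, k⟩
  · rintro p r ⟨q, hpq, hqr⟩
    exact (hR.atom _ _ hpq).trans (hS.atom _ _ hqr)
  · rintro p r ⟨q, hpq, hqr⟩ p' hp
    obtain ⟨q', hq, hpq'⟩ := hR.forth _ _ hpq _ hp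
    obtain ⟨r', hr, hqr'⟩ := hS.forth _ _ hqr _ hq
    exact ⟨r', hr, q', hpq', hqr'⟩
  · rintro p r ⟨q, hpq, hqr⟩ r' hr
    obtain ⟨q', hq, hqr'⟩ := hS.back _ _ hqr _ hr
    obtain ⟨p', hp, hpq'⟩ := hR.back _ _ hpq _ hq
    exact ⟨p', hp, q', hpq', hqr'⟩

instance setoid (𝒜 : Type v) : Setoid (PointedGraph.{u, v} 𝒜) where
  r := Bisimilar
  iseqv := ⟨Bisimilar.refl, Bisimilar.symm, Bisimilar.trans⟩

/-- The disjoint union of the graphs `G i`, with a new root pointing to all of their roots. -/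
def join {ι : Type u} (G : ι → PointedGraph.{u, v} 𝒜) : PointedGraph.{u, v} 𝒜 where
  Node := Option (Σ i, (G i).Node)
  edge := fun
    | none, some q => q.2 = (G q.1).root
    | some p, some q => ∃ h : p.1 = q.1, (G q.1).edge (h ▸ p.2) q.2
    | _, none => False
  atom := fun
    | none => none
    | some p => (G p.1).atom p.2
  leaf := by
    rintro (_ | ⟨i, p⟩) (_ | ⟨j, q⟩) h
    · rfl
    · rfl
    · exact h.elim
    · obtain ⟨h, h'⟩ := h
      cases h
      exact (G i).leaf _ _ h'
  root := none

end PointedGraph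

/-- Hypersets (and urelements) over `𝒜`. -/
def Hyperset (𝒜 : Type v) : Type (max (u + 1) v) := Quotient (PointedGraph.setoid.{u, v} 𝒜)

namespace Hyperset

variable {𝒜 : Type v}

/-- The hyperset pictured by a pointed graph. -/
def mk (G : PointedGraph.{u, v} 𝒜) : Hyperset.{u, v} 𝒜 := Quotient.mk _ G

/-- Membership: `x ∈ y` when `y` has a picture in which `x` is pictured by a child of the root. -/
instance : Membership (Hyperset.{u, v} 𝒜) (Hyperset.{u, v} 𝒜) where
  mem y x := ∃ (G : PointedGraph.{u, v} 𝒜) (p : G.Node),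
    G.edge G.root p ∧ y = mk G ∧ x = mk (G.at' p)

/-- `x` is a set, i.e. not an urelement. -/
def IsSet (x : Hyperset.{u, v} 𝒜) : Prop :=
  ∃ G : PointedGraph.{u, v} 𝒜, G.atom G.root = none ∧ x = mk G

/-- A pointed graph that pictures `x`. -/
noncomputable def picture (x : Hyperset.{u, v} 𝒜) : PointedGraph.{u, v} 𝒜 := Quotient.out x

theorem mk_picture (x : Hyperset.{u, v} 𝒜) : mk x.picture = x := Quotient.out_eq x

/-- The set `{f i | i}` of the members of a small family. -/
noncomputable def ofFamily {ι : Type u} (f : ι → Hyperset.{u, v} 𝒜) : Hyperset.{u, v} 𝒜 :=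
  mk (PointedGraph.join fun i => (f i).picture)

noncomputable instance : EmptyCollection (Hyperset.{u, v} 𝒜) where
  emptyCollection := ofFamily PEmpty.elim

/-- The unordered pair `{x, y}`. -/
noncomputable def upair (x y : Hyperset.{u, v} 𝒜) : Hyperset.{u, v} 𝒜 :=
  ofFamily fun i : ULift.{u} Bool => if i.down then x else y

noncomputable instance : Singleton (Hyperset.{u, v} 𝒜) (Hyperset.{u, v} 𝒜) where
  singleton x := upair x x

/-- The Kuratowski ordered pair `(x, y) = {{x}, {x, y}}`. -/
noncomputable def pair (x y : Hyperset.{u, v} 𝒜) : Hyperset.{u, v} 𝒜 := upair {x} (upair x y)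

/-- `f` is (the graph of) a total function from `A` to `B`. -/
def IsFunction (A B f : Hyperset.{u, v} 𝒜) : Prop :=
  f.IsSet ∧ (∀ p ∈ f, ∃ x ∈ A, ∃ y ∈ B, p = pair x y) ∧ ∀ x ∈ A, ∃! y, pair x y ∈ f

end Hyperset

/-! ## The category of hypersets and total maps -/

/-- An object of the category **AFA**: a set (not an urelement) of the hyperset universe. -/
structure AFA (𝒜 : Type v) : Type (max (u + 1) v) where
  carrier : Hyperset.{u, v} 𝒜
  isSet : carrier.IsSet

namespace AFA

variable {𝒜 : Type v}

/-- The elements of an object. -/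
def Elem (A : AFA.{u, v} 𝒜) : Type (max (u + 1) v) := {x : Hyperset.{u, v} 𝒜 // x ∈ A.carrier}

/-- Morphisms are total maps between the elements. -/
@[ext]
structure Hom (A B : AFA.{u, v} 𝒜) : Type (max (u + 1) v) where
  app : A.Elem → B.Elem

instance : Category.{max (u + 1) v} (AFA.{u, v} 𝒜) where
  Hom := Hom
  id A := ⟨fun x => x⟩
  comp f g := ⟨fun x => g.app (f.app x)⟩

end AFA

/-! ## Lawvere's notions -/

/-- `f : A × A → B` is weakly point surjective: every `p : A → B` is represented by some point
`x` of `A`, i.e. `p ∘ y = f ∘ ⟨x, y⟩` for all points `y`. -/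
def WeaklyPointSurjective {C : Type u} [Category.{v} C] [CartesianMonoidalCategory C] {A B : C}
    (f : A ⊗ A ⟶ B) : Prop :=
  ∀ p : A ⟶ B, ∃ x : 𝟙_ C ⟶ A, ∀ y : 𝟙_ C ⟶ A, y ≫ p = lift x y ≫ f

/-- `g : A → Y ^ A` is weakly point surjective: its transpose `(x, y) ↦ g(x)(y)` is. -/
def WeaklyPointSurjectiveToExp {C : Type u} [Category.{v} C] [CartesianMonoidalCategory C]
    [MonoidalClosed C] {A Y : C} (g : A ⟶ (ihom A).obj Y) : Prop :=
  WeaklyPointSurjective (lift (snd A A) (fst A A) ≫ MonoidalClosed.uncurry g)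

/-- Every endomorphism of `X` fixes a point of `X`. -/
def FixedPointProperty {C : Type u} [Category.{v} C] [CartesianMonoidalCategory C] (X : C) : Prop :=
  ∀ f : X ⟶ X, ∃ x : 𝟙_ C ⟶ X, x ≫ f = x

/-! ## Non-well-founded belief models -/

inductive Player : Type
  | a
  | b

/-- A non-well-founded belief model for two players: a nonempty hyperset `W` of states, a valuation
of the propositional variables, and the type spaces of the two players, which cover `W`. The type
spaces may, but need not, be disjoint. -/
structure NWFBeliefModel (𝒜 : Type v) (Var : Type w) : Type (max (u + 1) v w) where
  W : Hyperset.{u, v} 𝒜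
  nonempty : ∃ s, s ∈ W
  V : Var → Set {s : Hyperset.{u, v} 𝒜 // s ∈ W}
  U : Player → Set {s : Hyperset.{u, v} 𝒜 // s ∈ W}
  cover : U Player.a ∪ U Player.b = Set.univ

/-- Modal formulas. `type i` is the proposition `𝐔ⁱ`, `belief i j` is `□ⁱʲ`, `assumption i j` is
`♡ⁱʲ`, and `diag i j` is the special proposition `𝐃ⁱʲ` for the diagonal set. -/
inductive BeliefFormula (Var : Type w) : Type w
  | var : Var → BeliefFormula Var
  | top : BeliefFormula Var
  | type : Player → BeliefFormula Var
  | diag : Player → Player → BeliefFormula Var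
  | neg : BeliefFormula Var → BeliefFormula Var
  | and : BeliefFormula Var → BeliefFormula Var → BeliefFormula Var
  | box : BeliefFormula Var → BeliefFormula Var
  | belief : Player → Player → BeliefFormula Var → BeliefFormula Var
  | assumption : Player → Player → BeliefFormula Var → BeliefFormula Var

/-- `◇ⁱʲ`, the dual of `□ⁱʲ`. -/
def BeliefFormula.dia {Var : Type w} (i j : Player) (φ : BeliefFormula Var) : BeliefFormula Var :=
  .neg (.belief i j (.neg φ))

/-- The Brandenburger-Keisler sentence `□ⁱʲ ♡ʲⁱ 𝐃ⁱʲ ∧ ◇ⁱʲ ⊤`: player `i`, who considers some state of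
`j` possible, believes that `j` assumes that `i` believes that `j`'s assumption is wrong. -/
def BeliefFormula.bk {Var : Type w} (i j : Player) : BeliefFormula Var :=
  .and (.belief i j (.assumption j i (.diag i j))) (.dia i j .top)

/-- The first-order language of belief models: a unary predicate for each type space and a binary
one for membership. -/
inductive BeliefRel : ℕ → Type
  | type : Player → BeliefRel 1
  | mem : BeliefRel 2

def beliefLanguage : FirstOrder.Language.{0, 0} := ⟨fun _ => Empty, BeliefRel⟩

namespace NWFBeliefModel

variable {𝒜 : Type v} {Var : Type w}

def State (M : NWFBeliefModel.{u, v, w} 𝒜 Var) : Type (max (u + 1) v) :=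
  {s : Hyperset.{u, v} 𝒜 // s ∈ M.W}

/-- The semantics `M, s ⊨⁺ φ`; accessibility is membership. -/
def Sat (M : NWFBeliefModel.{u, v, w} 𝒜 Var) : M.State → BeliefFormula Var → Prop
  | s, .var p => s ∈ M.V p
  | _, .top => True
  | s, .type i => s ∈ M.U i
  | s, .diag i j => s ∈ M.U i ∧ ∀ t : M.State, t ∈ M.U j → t.1 ∈ s.1 → s.1 ∉ t.1
  | s, .neg φ => ¬ M.Sat s φ
  | s, .and φ ψ => M.Sat s φ ∧ M.Sat s ψ
  | s, .box φ => ∀ t : M.State, t.1 ∈ s.1 → M.Sat t φ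
  | s, .belief i j φ => s ∈ M.U i ∧ ∀ t : M.State, t.1 ∈ s.1 ∧ t ∈ M.U j → M.Sat t φ
  | s, .assumption i j φ => s ∈ M.U i ∧ ∀ t : M.State, (t.1 ∈ s.1 ∧ t ∈ M.U j) ↔ M.Sat t φ

/-- At state `s`, player `i` assumes the predicate `P` about player `j`. -/
def Assumes (M : NWFBeliefModel.{u, v, w} 𝒜 Var) (i j : Player) (s : M.State) (P : Set M.State) :
    Prop :=
  s ∈ M.U i ∧ ∀ t : M.State, (t.1 ∈ s.1 ∧ t ∈ M.U j) ↔ t ∈ P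

/-- Assumption completeness with respect to a set `Π` of predicates: every predicate of `Π` on the
type space of one player is assumed by the other player at some state. -/
def AssumptionComplete (M : NWFBeliefModel.{u, v, w} 𝒜 Var) (Pi : Set (Set M.State)) : Prop :=
  (∀ P ∈ Pi, P ⊆ M.U Player.b → ∃ s, M.Assumes Player.a Player.b s P) ∧
    (∀ P ∈ Pi, P ⊆ M.U Player.a → ∃ s, M.Assumes Player.b Player.a s P)

/-- The predicates defined by modal formulas. -/
def modalPredicates (M : NWFBeliefModel.{u, v, w} 𝒜 Var) : Set (Set M.State) :=
  {P | ∃ φ : BeliefFormula Var, P = {s | M.Sat s φ}}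

instance (M : NWFBeliefModel.{u, v, w} 𝒜 Var) : beliefLanguage.Structure M.State where
  funMap := fun f => f.elim
  RelMap := fun
    | .type i, x => x 0 ∈ M.U i
    | .mem, x => (x 0).1 ∈ (x 1).1

/-- The predicates definable, without parameters, in the first-order language of `M`. -/
def firstOrderPredicates (M : NWFBeliefModel.{u, v, w} 𝒜 Var) : Set (Set M.State) :=
  {P | (∅ : Set M.State).Definable₁ beliefLanguage P}

end NWFBeliefModel

/-! ### Membership, extensionality and set formation for hypersets -/

namespace Hyperset

variable {𝒜 : Type v}

/-! Modulo bisimilarity, membership is extensional on sets, and every small family of hypersets is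
the family of members of a set. This alone, with no foundation, gives Kuratowski pairs and sets of
functions; their elements correspond to pairs of elements and to maps (`prodEquiv`, `expEquiv`), so
the cartesian closed structure is that of types, carried along these bijections. Lawvere's lemma is
the diagonal argument in any category with finite products.

The belief part is Russell-like. If `s` satisfies the BK sentence, every member of `s` in `U j`
assumes the diagonal set, so it contains `s` exactly when `s` is diagonal; both answers are absurd
(`not_sat_bk`). A complete model would realise the BK sentence, and completeness for just two
predicates suffices for that (`not_assumptionComplete`); both are modally and first-order definable.
-/

theorem mk_eq_mk {G H : PointedGraph.{u, v} 𝒜} : mk G = mk H ↔ G.Bisimilar H :=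
  Quotient.eq (r := PointedGraph.setoid 𝒜)

/-- Membership may be tested on any picture: the back clause of a bisimulation moves a child from
one picture to another. -/
theorem mem_mk {G : PointedGraph.{u, v} 𝒜} {x : Hyperset.{u, v} 𝒜} :
    x ∈ mk G ↔ ∃ p, G.edge G.root p ∧ x = mk (G.at' p) := by
  constructor
  · rintro ⟨H, q, hq, hGH, rfl⟩
    obtain ⟨R, hR, h⟩ := mk_eq_mk.1 hGH
    obtain ⟨p, hp, hpq⟩ := hR.back _ _ h _ hq
    exact ⟨p, hp, mk_eq_mk.2 (PointedGraph.Bisimilar.symm (G := G.at' p) (H := H.at' q)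
      ⟨R, ⟨hR.atom, hR.forth, hR.back⟩, hpq⟩)⟩
  · rintro ⟨p, hp, rfl⟩
    exact ⟨G, p, hp, rfl, rfl⟩

/-- Sets with the same members are equal. -/
theorem IsSet.ext {x y : Hyperset.{u, v} 𝒜} (hx : x.IsSet) (hy : y.IsSet)
    (h : ∀ z, z ∈ x ↔ z ∈ y) : x = y := by
  obtain ⟨G, hG, rfl⟩ := hx
  obtain ⟨H, hH, rfl⟩ := hy
  -- Bisimilarity of nodes, enlarged by the pair of roots. Below the roots the hypothesis on members
  -- applies; the roots' labels agree because neither is an urelement.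
  refine mk_eq_mk.2 ⟨fun p q => (p = G.root ∧ q = H.root) ∨ mk (G.at' p) = mk (H.at' q),
    ⟨?_, ?_, ?_⟩, Or.inl ⟨rfl, rfl⟩⟩
  · rintro p q (⟨rfl, rfl⟩ | hpq)
    · rw [hG, hH]
    · obtain ⟨R, hR, hr⟩ := mk_eq_mk.1 hpq
      exact hR.atom _ _ hr
  · rintro p q (⟨rfl, rfl⟩ | hpq) p' hp
    · obtain ⟨q', hq, e⟩ := mem_mk.1 ((h _).1 (mem_mk.2 ⟨p', hp, rfl⟩))
      exact ⟨q', hq, Or.inr e⟩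
    · have : mk (G.at' p') ∈ mk (G.at' p) := mem_mk.2 ⟨p', hp, rfl⟩
      rw [hpq] at this
      obtain ⟨q', hq, e⟩ := mem_mk.1 this
      exact ⟨q', hq, Or.inr e⟩
  · rintro p q (⟨rfl, rfl⟩ | hpq) q' hq
    · obtain ⟨p', hp, e⟩ := mem_mk.1 ((h _).2 (mem_mk.2 ⟨q', hq, rfl⟩))
      exact ⟨p', hp, Or.inr e.symm⟩
    · have : mk (H.at' q') ∈ mk (H.at' q) := mem_mk.2 ⟨q', hq, rfl⟩
      rw [← hpq] at this
      obtain ⟨p', hp, e⟩ := mem_mk.1 this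
      exact ⟨p', hp, Or.inr e.symm⟩

/-- No arrow leaves the copy of `G i` inside the join, so the inclusion of that copy is a
bisimulation. -/
theorem mk_join_at' {ι : Type u} (G : ι → PointedGraph.{u, v} 𝒜) (i : ι) :
    mk ((PointedGraph.join G).at' (some ⟨i, (G i).root⟩)) = mk (G i) := by
  refine mk_eq_mk.2 ⟨fun p q => p = some ⟨i, q⟩, ⟨?_, ?_, ?_⟩, rfl⟩
  · rintro _ q rfl
    rfl
  · rintro _ q rfl (_ | ⟨j, q'⟩) h
    · exact h.elim
    · obtain ⟨h, h'⟩ := h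
      cases h
      exact ⟨q', h', rfl⟩
  · rintro _ q rfl q' h
    exact ⟨some ⟨i, q'⟩, ⟨rfl, h⟩, rfl⟩

theorem mem_ofFamily {ι : Type u} {f : ι → Hyperset.{u, v} 𝒜} {x : Hyperset.{u, v} 𝒜} :
    x ∈ ofFamily f ↔ ∃ i, x = f i := by
  rw [ofFamily, mem_mk]
  constructor
  · rintro ⟨_ | ⟨i, p⟩, h, rfl⟩
    · exact h.elim
    · have hp : p = (f i).picture.root := h
      subst hp
      exact ⟨i, (mk_join_at' (fun i => (f i).picture) i).trans (mk_picture _)⟩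
  · rintro ⟨i, rfl⟩
    exact ⟨some ⟨i, (f i).picture.root⟩, rfl,
      ((mk_join_at' (fun i => (f i).picture) i).trans (mk_picture _)).symm⟩

theorem isSet_ofFamily {ι : Type u} (f : ι → Hyperset.{u, v} 𝒜) : (ofFamily f).IsSet :=
  ⟨_, rfl, rfl⟩

theorem mem_upair {x y z : Hyperset.{u, v} 𝒜} : z ∈ upair x y ↔ z = x ∨ z = y := by
  rw [upair, mem_ofFamily]
  constructor
  · rintro ⟨⟨_ | _⟩, h⟩
    · exact Or.inr h
    · exact Or.inl h
  · rintro (h | h)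
    · exact ⟨⟨true⟩, h⟩
    · exact ⟨⟨false⟩, h⟩

theorem mem_singleton {x z : Hyperset.{u, v} 𝒜} : z ∈ ({x} : Hyperset.{u, v} 𝒜) ↔ z = x :=
  mem_upair.trans (or_self_iff)

theorem upair_eq_upair {x y x' y' : Hyperset.{u, v} 𝒜} (h : upair x y = upair x' y') :
    (x = x' ∧ y = y') ∨ (x = y' ∧ y = x') := by
  have key : ∀ z, (z = x ∨ z = y) ↔ (z = x' ∨ z = y') := fun z => by
    rw [← mem_upair, h, mem_upair]
  have h1 := (key x).1 (Or.inl rfl)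
  have h2 := (key y).1 (Or.inr rfl)
  have h3 := (key x').2 (Or.inl rfl)
  have h4 := (key y').2 (Or.inr rfl)
  grind

/-- The Kuratowski coding is decoded from membership alone; in the crossed case all the components
coincide. -/
theorem pair_inj {x y x' y' : Hyperset.{u, v} 𝒜} (h : pair x y = pair x' y') :
    x = x' ∧ y = y' := by
  have key : ∀ {a b c : Hyperset.{u, v} 𝒜}, upair a a = upair b c → a = b ∧ a = c := by
    intro a b c h
    obtain h | h := upair_eq_upair h
    · exact h
    · exact h.symm
  obtain ⟨h1, h2⟩ | ⟨h1, h2⟩ := upair_eq_upair h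
  · obtain rfl := (key h1).1
    obtain h | h := upair_eq_upair h2
    · exact h
    · exact ⟨rfl, h.2.trans h.1⟩
  · obtain ⟨rfl, rfl⟩ := key h1
    obtain ⟨h3, h4⟩ := key h2.symm
    exact ⟨rfl, h4.symm⟩

/-- The children of the root in one picture, nodes at level `u`, cover the members. This smallness
is what allows products and function sets to be formed as hypersets. -/
instance small_mem (x : Hyperset.{u, v} 𝒜) : Small.{u} {z : Hyperset.{u, v} 𝒜 // z ∈ x} := by
  obtain ⟨G, rfl⟩ := Quotient.exists_rep x
  refine small_of_surjective (α := {p : G.Node // G.edge G.root p})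
    (f := fun p => ⟨mk (G.at' p.1), mem_mk.2 ⟨p.1, p.2, rfl⟩⟩) ?_
  rintro ⟨z, hz⟩
  obtain ⟨p, hp, rfl⟩ := mem_mk.1 hz
  exact ⟨⟨p, hp⟩, rfl⟩

/-- The set of the members of a family indexed by a small type. -/
noncomputable def range {ι : Type*} [Small.{u} ι] (f : ι → Hyperset.{u, v} 𝒜) :
    Hyperset.{u, v} 𝒜 :=
  ofFamily fun i : Shrink.{u} ι => f ((equivShrink ι).symm i)

theorem mem_range {ι : Type*} [Small.{u} ι] {f : ι → Hyperset.{u, v} 𝒜}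
    {x : Hyperset.{u, v} 𝒜} : x ∈ range f ↔ ∃ i, x = f i := by
  rw [range, mem_ofFamily]
  exact (equivShrink ι).symm.exists_congr_left.trans (by simp)

theorem isSet_range {ι : Type*} [Small.{u} ι] (f : ι → Hyperset.{u, v} 𝒜) : (range f).IsSet :=
  isSet_ofFamily _

end Hyperset

/-! ### Sets of pairs and sets of functions -/

namespace AFA

variable {𝒜 : Type v}

instance (A : AFA.{u, v} 𝒜) : Small.{u} A.Elem := Hyperset.small_mem A.carrier

theorem hom_ext {A B : AFA.{u, v} 𝒜} {f g : A ⟶ B} (h : ∀ x, Hom.app f x = Hom.app g x) : f = g :=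
  Hom.ext (funext h)

/-- The set `{∅}`. -/
noncomputable def one (𝒜 : Type v) : AFA.{u, v} 𝒜 := ⟨{∅}, Hyperset.isSet_ofFamily _⟩

noncomputable instance : Unique (one.{u, v} 𝒜).Elem where
  default := ⟨∅, Hyperset.mem_singleton.2 rfl⟩
  uniq x := Subtype.ext (Hyperset.mem_singleton.1 x.2)

/-- The set of Kuratowski pairs of elements of `A` and `B`. -/
noncomputable def prod (A B : AFA.{u, v} 𝒜) : AFA.{u, v} 𝒜 :=
  ⟨Hyperset.range fun p : A.Elem × B.Elem => Hyperset.pair p.1.1 p.2.1, Hyperset.isSet_range _⟩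

theorem mem_prod {A B : AFA.{u, v} 𝒜} {z : Hyperset.{u, v} 𝒜} :
    z ∈ (prod A B).carrier ↔ ∃ p : A.Elem × B.Elem, z = Hyperset.pair p.1.1 p.2.1 :=
  Hyperset.mem_range (f := fun p : A.Elem × B.Elem => Hyperset.pair p.1.1 p.2.1)

/-- The elements of `prod A B` are the pairs of elements of `A` and `B`. -/
noncomputable def prodEquiv (A B : AFA.{u, v} 𝒜) : A.Elem × B.Elem ≃ (prod A B).Elem :=
  Equiv.ofBijective (fun p => ⟨Hyperset.pair p.1.1 p.2.1, mem_prod.2 ⟨p, rfl⟩⟩) <| by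
    constructor
    · intro p q h
      obtain ⟨h1, h2⟩ := Hyperset.pair_inj (congrArg Subtype.val h)
      exact Prod.ext (Subtype.ext h1) (Subtype.ext h2)
    · rintro ⟨z, hz⟩
      obtain ⟨p, rfl⟩ := mem_prod.1 hz
      exact ⟨p, rfl⟩

/-- The set of pairs that is the graph of a map. -/
noncomputable def graph {A B : AFA.{u, v} 𝒜} (f : A.Elem → B.Elem) : Hyperset.{u, v} 𝒜 :=
  Hyperset.range fun x => Hyperset.pair x.1 (f x).1

theorem pair_mem_graph {A B : AFA.{u, v} 𝒜} {f : A.Elem → B.Elem} {x y : Hyperset.{u, v} 𝒜} :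
    Hyperset.pair x y ∈ graph f ↔ ∃ h : x ∈ A.carrier, y = (f ⟨x, h⟩).1 := by
  rw [graph, Hyperset.mem_range]
  constructor
  · rintro ⟨a, h⟩
    obtain ⟨rfl, rfl⟩ := Hyperset.pair_inj h
    exact ⟨a.2, rfl⟩
  · rintro ⟨h, rfl⟩
    exact ⟨⟨x, h⟩, rfl⟩

theorem graph_injective {A B : AFA.{u, v} 𝒜} :
    Function.Injective (graph : (A.Elem → B.Elem) → Hyperset.{u, v} 𝒜) := by
  intro f g h
  funext x
  have hx : Hyperset.pair x.1 (f x).1 ∈ graph f := pair_mem_graph.2 ⟨x.2, rfl⟩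
  rw [h] at hx
  exact Subtype.ext (pair_mem_graph.1 hx).2

/-- Extensionality identifies an internal function with the graph of the map it induces. The `IsSet`
clause matters for empty `A`, where an urelement would meet the other clauses vacuously. -/
theorem isFunction_iff {A B : AFA.{u, v} 𝒜} {f : Hyperset.{u, v} 𝒜} :
    Hyperset.IsFunction A.carrier B.carrier f ↔ ∃ φ : A.Elem → B.Elem, f = graph φ := by
  constructor
  · rintro ⟨hf, hsub, hfun⟩
    -- The unique value in `IsFunction` ranges over all hypersets; that it lies in `B` comes from
    -- the clause on members of `f`.
    have hB : ∀ x y, Hyperset.pair x y ∈ f → y ∈ B.carrier := by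
      intro x y h
      obtain ⟨x', _, y', hy', e⟩ := hsub _ h
      rwa [(Hyperset.pair_inj e).2]
    choose g hg hu using fun x : A.Elem => hfun x.1 x.2
    refine ⟨fun x => ⟨g x, hB _ _ (hg x)⟩,
      hf.ext (Hyperset.isSet_range _) fun z => ⟨fun hz => ?_, fun hz => ?_⟩⟩
    · obtain ⟨x, hx, y, _, rfl⟩ := hsub z hz
      exact pair_mem_graph.2 ⟨hx, hu ⟨x, hx⟩ y hz⟩
    · obtain ⟨x, rfl⟩ := Hyperset.mem_range.1 hz
      exact hg x
  · rintro ⟨φ, rfl⟩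
    refine ⟨Hyperset.isSet_range _, fun p hp => ?_, fun x hx => ?_⟩
    · obtain ⟨x, rfl⟩ := Hyperset.mem_range.1 hp
      exact ⟨x.1, x.2, (φ x).1, (φ x).2, rfl⟩
    · exact ⟨(φ ⟨x, hx⟩).1, pair_mem_graph.2 ⟨hx, rfl⟩, fun y hy => (pair_mem_graph.1 hy).2⟩

/-- The set of all total functions from `A` to `B`. -/
noncomputable def exp (A B : AFA.{u, v} 𝒜) : AFA.{u, v} 𝒜 :=
  ⟨Hyperset.range (graph : (A.Elem → B.Elem) → _), Hyperset.isSet_range _⟩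

theorem mem_exp {A B : AFA.{u, v} 𝒜} {z : Hyperset.{u, v} 𝒜} :
    z ∈ (exp A B).carrier ↔ ∃ φ : A.Elem → B.Elem, z = graph φ :=
  Hyperset.mem_range

/-- The elements of `exp A B` are the maps from `A` to `B`. -/
noncomputable def expEquiv (A B : AFA.{u, v} 𝒜) : (A.Elem → B.Elem) ≃ (exp A B).Elem :=
  Equiv.ofBijective (fun φ => ⟨graph φ, mem_exp.2 ⟨φ, rfl⟩⟩) <| by
    constructor
    · intro φ ψ h
      exact graph_injective (congrArg Subtype.val h)
    · rintro ⟨z, hz⟩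
      obtain ⟨φ, rfl⟩ := mem_exp.1 hz
      exact ⟨φ, rfl⟩

end AFA

/-! ### The cartesian closed structure -/

namespace AFA

variable {𝒜 : Type v}

@[simp]
theorem comp_app {A B C : AFA.{u, v} 𝒜} (f : A ⟶ B) (g : B ⟶ C) (x : A.Elem) :
    Hom.app (f ≫ g) x = Hom.app g (Hom.app f x) := rfl

/-- The morphism given by a map. -/
def ofFun {A B : AFA.{u, v} 𝒜} (f : A.Elem → B.Elem) : A ⟶ B := (⟨f⟩ : Hom A B)

@[simp]
theorem ofFun_app {A B : AFA.{u, v} 𝒜} (f : A.Elem → B.Elem) (x : A.Elem) :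
    Hom.app (ofFun f) x = f x := rfl

noncomputable def isTerminalOne : Limits.IsTerminal (one.{u, v} 𝒜) :=
  .ofUniqueHom (fun _ => ofFun fun _ => default) fun _ _ => hom_ext fun _ => Subsingleton.elim _ _

noncomputable def prodFan (A B : AFA.{u, v} 𝒜) : Limits.BinaryFan A B :=
  .mk (P := prod A B) (ofFun fun z => ((prodEquiv A B).symm z).1)
    (ofFun fun z => ((prodEquiv A B).symm z).2)

noncomputable def isLimitProdFan (A B : AFA.{u, v} 𝒜) : Limits.IsLimit (prodFan A B) :=
  Limits.BinaryFan.IsLimit.mk _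
    (fun f g => ofFun fun t => prodEquiv A B (Hom.app f t, Hom.app g t))
    (fun f g => hom_ext fun t => by simp [prodFan])
    (fun f g => hom_ext fun t => by simp [prodFan])
    (fun f g m h₁ h₂ => hom_ext fun t => by
      subst h₁ h₂
      exact ((prodEquiv A B).apply_symm_apply _).symm)

noncomputable instance : CartesianMonoidalCategory (AFA.{u, v} 𝒜) :=
  .ofChosenFiniteProducts ⟨_, isTerminalOne⟩ fun A B => ⟨_, isLimitProdFan A B⟩

/-- The elements of `A ⊗ B` are the pairs of elements of `A` and `B`. -/
noncomputable def tensorEquiv (A B : AFA.{u, v} 𝒜) : A.Elem × B.Elem ≃ (A ⊗ B).Elem :=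
  prodEquiv A B

theorem fst_app (A B : AFA.{u, v} 𝒜) (p : A.Elem × B.Elem) :
    Hom.app (fst A B) (tensorEquiv A B p) = p.1 :=
  congrArg Prod.fst ((prodEquiv A B).symm_apply_apply p)

theorem snd_app (A B : AFA.{u, v} 𝒜) (p : A.Elem × B.Elem) :
    Hom.app (snd A B) (tensorEquiv A B p) = p.2 :=
  congrArg Prod.snd ((prodEquiv A B).symm_apply_apply p)

theorem tensorEquiv_fst_snd (A B : AFA.{u, v} 𝒜) (z : (A ⊗ B).Elem) :
    tensorEquiv A B (Hom.app (fst A B) z, Hom.app (snd A B) z) = z :=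
  (prodEquiv A B).apply_symm_apply z

theorem whiskerLeft_app (A : AFA.{u, v} 𝒜) {X Y : AFA.{u, v} 𝒜} (f : X ⟶ Y)
    (p : A.Elem × X.Elem) :
    Hom.app (A ◁ f) (tensorEquiv A X p) = tensorEquiv A Y (p.1, Hom.app f p.2) := by
  rw [← tensorEquiv_fst_snd A Y (Hom.app (A ◁ f) _), ← comp_app, ← comp_app,
    whiskerLeft_fst, whiskerLeft_snd, comp_app, fst_app, snd_app]

/-- The exponential functor `B ↦ B ^ A`. -/
noncomputable def expFunctor (A : AFA.{u, v} 𝒜) : AFA.{u, v} 𝒜 ⥤ AFA.{u, v} 𝒜 where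
  obj := exp A
  map {X Y} f := ofFun fun φ => expEquiv A Y (Hom.app f ∘ (expEquiv A X).symm φ)
  map_id X := hom_ext fun φ => (expEquiv A X).apply_symm_apply φ
  map_comp f g := hom_ext fun φ => by simp [Function.comp_def]

/-- Currying. -/
noncomputable def curryEquiv (A X Y : AFA.{u, v} 𝒜) : (A ⊗ X ⟶ Y) ≃ (X ⟶ exp A Y) where
  toFun f := ofFun fun x => expEquiv A Y fun a => Hom.app f (tensorEquiv A X (a, x))
  invFun g := ofFun fun z =>
    (expEquiv A Y).symm (Hom.app g (Hom.app (snd A X) z)) (Hom.app (fst A X) z)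
  left_inv f := hom_ext fun z => by
    simp only [ofFun_app, Equiv.symm_apply_apply]
    exact congrArg (Hom.app f) (tensorEquiv_fst_snd A X z)
  right_inv g := hom_ext fun x => by
    simp only [ofFun_app, fst_app, snd_app]
    exact (expEquiv A Y).apply_symm_apply _

theorem curryEquiv_symm_app (A X Y : AFA.{u, v} 𝒜) (g : X ⟶ exp A Y) (p : A.Elem × X.Elem) :
    Hom.app ((curryEquiv A X Y).symm g) (tensorEquiv A X p) =
      (expEquiv A Y).symm (Hom.app g p.2) p.1 := by
  change (expEquiv A Y).symm (Hom.app g (Hom.app (snd A X) _)) (Hom.app (fst A X) _) = _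
  rw [fst_app, snd_app]

theorem curryEquiv_symm_comp (A : AFA.{u, v} 𝒜) {X' X Y : AFA.{u, v} 𝒜} (f : X' ⟶ X)
    (g : X ⟶ exp A Y) :
    (curryEquiv A X' Y).symm (f ≫ g) = A ◁ f ≫ (curryEquiv A X Y).symm g :=
  hom_ext fun z => by
    obtain ⟨p, rfl⟩ := (tensorEquiv A X').surjective z
    rw [comp_app, whiskerLeft_app, curryEquiv_symm_app, curryEquiv_symm_app, comp_app]

theorem curryEquiv_comp (A : AFA.{u, v} 𝒜) {X Y Y' : AFA.{u, v} 𝒜} (f : A ⊗ X ⟶ Y)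
    (g : Y ⟶ Y') :
    curryEquiv A X Y' (f ≫ g) = curryEquiv A X Y f ≫ (expFunctor A).map g :=
  hom_ext fun x => congrArg (fun φ => expEquiv A Y' (Hom.app g ∘ φ))
    ((expEquiv A Y).symm_apply_apply fun a => Hom.app f (tensorEquiv A X (a, x))).symm

noncomputable def expAdjunction (A : AFA.{u, v} 𝒜) : tensorLeft A ⊣ expFunctor A :=
  Adjunction.mkOfHomEquiv
    { homEquiv := curryEquiv A
      homEquiv_naturality_left_symm := curryEquiv_symm_comp A
      homEquiv_naturality_right := curryEquiv_comp A }

noncomputable instance : MonoidalClosed (AFA.{u, v} 𝒜) where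
  closed A := ⟨expFunctor A, expAdjunction A⟩

/-- Evaluation is the counit of the adjunction, that is, the uncurried identity. -/
theorem ev_app (A B : AFA.{u, v} 𝒜) (p : A.Elem × ((ihom A).obj B).Elem) :
    Hom.app ((ihom.ev A).app B) (tensorEquiv A _ p) = (expEquiv A B).symm p.2 p.1 := by
  have : (ihom.ev A).app B = (curryEquiv A _ B).symm (𝟙 _) :=
    Adjunction.mkOfHomEquiv_counit_app ..
  rw [this]
  exact curryEquiv_symm_app A _ B (𝟙 _) p

end AFA

/-! ### Lawvere's diagonal argument -/

/-- **Lawvere's lemma**. -/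
theorem FixedPointProperty.of_weaklyPointSurjective {C : Type u} [Category.{v} C]
    [CartesianMonoidalCategory C] {A B : C} {f : A ⊗ A ⟶ B} (hf : WeaklyPointSurjective f) :
    FixedPointProperty B := by
  intro h
  -- The point `x` represents `y ↦ h (f (y, y))`; at `y = x` this says that `h` fixes `f (x, x)`.
  obtain ⟨x, hx⟩ := hf (lift (𝟙 A) (𝟙 A) ≫ f ≫ h)
  refine ⟨lift x x ≫ f, ?_⟩
  simpa [comp_lift_assoc] using hx x

/-! ### The BK sentence, incompleteness and definability -/

namespace NWFBeliefModel

variable {𝒜 : Type v} {Var : Type w}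

theorem not_sat_bk (M : NWFBeliefModel.{u, v, w} 𝒜 Var) (i j : Player) (s : M.State) :
    ¬ M.Sat s (BeliefFormula.bk i j) := by
  rintro ⟨⟨hs, hb⟩, hd⟩
  -- `◇ⁱʲ` also holds vacuously outside `U i`; since `s ∈ U i`, it yields a genuine member.
  have hd' : ∃ t : M.State, t.1 ∈ s.1 ∧ t ∈ M.U j := by
    by_contra! h
    exact hd ⟨hs, fun t ht => (h t ht.1 ht.2).elim⟩
  obtain ⟨t, hts, htj⟩ := hd'
  have key : ∀ r : M.State, r.1 ∈ s.1 → r ∈ M.U j → (s.1 ∈ r.1 ↔ M.Sat s (.diag i j)) :=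
    fun r hr hrj => by simpa [hs] using (hb r ⟨hr, hrj⟩).2 s
  -- If some such `r` contained `s`, then `s` would be diagonal by `key`, which forbids `s ∈ r`.
  have hsd : M.Sat s (.diag i j) := ⟨hs, fun r hrj hr hsr =>
    ((key r hr hrj).1 hsr).2 r hrj hr hsr⟩
  exact hsd.2 t htj hts ((key t hts htj).2 hsd)

/-- Let `t` assume the diagonal set, and let `s` assume the set of all states that do so. Then `s`
satisfies the belief conjunct of the BK sentence, and `t ∈ s` gives the possibility conjunct. -/
theorem not_assumptionComplete (M : NWFBeliefModel.{u, v, w} 𝒜 Var) {Pi : Set (Set M.State)}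
    (h₁ : {s | M.Sat s (.diag .a .b)} ∈ Pi)
    (h₂ : {s | M.Sat s (.assumption .b .a (.diag .a .b))} ∈ Pi) :
    ¬ M.AssumptionComplete Pi := by
  rintro ⟨hab, hba⟩
  obtain ⟨t, ht⟩ := hba _ h₁ fun s hs => hs.1
  obtain ⟨s, hs, hs'⟩ := hab _ h₂ fun s hs => hs.1
  refine M.not_sat_bk .a .b s ⟨⟨hs, fun r hr => (hs' r).1 hr⟩, fun h => ?_⟩
  exact h.2 t ((hs' t).2 ht) trivial

theorem definable_mem_type (M : NWFBeliefModel.{u, v, w} 𝒜 Var) (i : Player) {α : Type*} (a : α) :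
    (∅ : Set M.State).Definable beliefLanguage {x : α → M.State | x a ∈ M.U i} := by
  refine Set.empty_definable_iff.2
    ⟨FirstOrder.Language.Relations.formula₁ (L := beliefLanguage) (BeliefRel.type i) (.var a), ?_⟩
  ext x
  simp
  rfl

theorem definable_mem (M : NWFBeliefModel.{u, v, w} 𝒜 Var) {α : Type*} (a b : α) :
    (∅ : Set M.State).Definable beliefLanguage {x : α → M.State | (x a).1 ∈ (x b).1} := by
  refine Set.empty_definable_iff.2
    ⟨FirstOrder.Language.Relations.formula₂ (L := beliefLanguage) BeliefRel.mem (.var a) (.var b),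
      ?_⟩
  ext x
  simp
  rfl

theorem definable_sat_diag (M : NWFBeliefModel.{u, v, w} 𝒜 Var) (i j : Player) {α : Type*}
    (a : α) :
    (∅ : Set M.State).Definable beliefLanguage {x : α → M.State | M.Sat (x a) (.diag i j)} := by
  -- A block of variables indexed by `Unit` is a single quantifier: `.inr ()` is the bound variable,
  -- `.inl a` the free one.
  have h := (M.definable_mem_type i a).inter <| Set.Definable.forall_of_finite (β := Unit) <|
    (M.definable_mem_type j (α := α ⊕ Unit) (.inr ())).himp <|
      (M.definable_mem (.inr ()) (.inl a)).himp (M.definable_mem (.inl a) (.inr ())).compl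
  convert h using 1
  ext x
  refine and_congr Iff.rfl ⟨fun hx t => ?_, fun hx t htj hta => ?_⟩
  · simpa [himp_eq, imp_iff_not_or, or_comm, or_assoc] using hx (t ())
  · have := hx fun _ => t
    simp [himp_eq] at this
    tauto

theorem definable_sat_assumption_diag (M : NWFBeliefModel.{u, v, w} 𝒜 Var) (i j k l : Player)
    {α : Type*} (a : α) :
    (∅ : Set M.State).Definable beliefLanguage
      {x : α → M.State | M.Sat (x a) (.assumption i j (.diag k l))} := by
  have hs := (M.definable_mem (α := α ⊕ Unit) (.inr ()) (.inl a)).inter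
    (M.definable_mem_type j (.inr ()))
  have hd := M.definable_sat_diag k l (α := α ⊕ Unit) (.inr ())
  have h := (M.definable_mem_type i a).inter <|
    Set.Definable.forall_of_finite (β := Unit) ((hs.himp hd).inter (hd.himp hs))
  convert h using 1
  ext x
  refine and_congr Iff.rfl ⟨fun hx t => ?_, fun hx t => ?_⟩
  · have := hx (t ())
    simp [himp_eq]
    tauto
  · have := hx fun _ => t
    simp [himp_eq] at this
    tauto

end NWFBeliefModel

theorem corollary3p7 (𝒜 : Type v) (Var : Type w) :
    (∃ (_ : CartesianMonoidalCategory (AFA.{u, v} 𝒜)) (_ : MonoidalClosed (AFA.{u, v} 𝒜)),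
      (𝟙_ (AFA.{u, v} 𝒜)).carrier = {∅} ∧
      (∀ (A B : AFA.{u, v} 𝒜) (z : Hyperset.{u, v} 𝒜),
        z ∈ (A ⊗ B).carrier ↔ ∃ x ∈ A.carrier, ∃ y ∈ B.carrier, z = Hyperset.pair x y) ∧
      (∀ (A B : AFA.{u, v} 𝒜) (z : (A ⊗ B).Elem),
        z.1 = Hyperset.pair ((fst A B).app z).1 ((snd A B).app z).1) ∧
      (∀ (A B : AFA.{u, v} 𝒜) (f : Hyperset.{u, v} 𝒜),
        f ∈ ((ihom A).obj B).carrier ↔ Hyperset.IsFunction A.carrier B.carrier f) ∧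
      (∀ (A B : AFA.{u, v} 𝒜) (z : (A ⊗ (ihom A).obj B).Elem) (x f : Hyperset.{u, v} 𝒜),
        z.1 = Hyperset.pair x f →
          Hyperset.pair x (AFA.Hom.app ((ihom.ev A).app B) z).1 ∈ f) ∧
      (∀ (A Y : AFA.{u, v} 𝒜) (g : A ⟶ (ihom A).obj Y),
        WeaklyPointSurjectiveToExp g → FixedPointProperty Y)) ∧
    (∀ (M : NWFBeliefModel.{u, v, w} 𝒜 Var) (i j : Player), i ≠ j →
      ∀ s : M.State, ¬ M.Sat s (BeliefFormula.bk i j)) ∧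
    (∀ M : NWFBeliefModel.{u, v, w} 𝒜 Var,
      ¬ M.AssumptionComplete M.modalPredicates ∧
      ¬ M.AssumptionComplete M.firstOrderPredicates) := by
  refine ⟨⟨inferInstance, inferInstance, rfl, fun A B z => ?_, fun A B z => ?_, fun A B f => ?_,
    fun A B z x f h => ?_, fun A Y g hg => .of_weaklyPointSurjective hg⟩,
    fun M i j _ => M.not_sat_bk i j, fun M => ⟨?_, ?_⟩⟩
  · refine AFA.mem_prod.trans ⟨?_, ?_⟩
    · rintro ⟨p, rfl⟩
      exact ⟨p.1.1, p.1.2, p.2.1, p.2.2, rfl⟩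
    · rintro ⟨x, hx, y, hy, rfl⟩
      exact ⟨(⟨x, hx⟩, ⟨y, hy⟩), rfl⟩
  · exact (congrArg Subtype.val (AFA.tensorEquiv_fst_snd A B z)).symm
  · exact AFA.mem_exp.trans AFA.isFunction_iff.symm
  · obtain ⟨⟨a, φ⟩, rfl⟩ := (AFA.tensorEquiv A _).surjective z
    obtain ⟨ψ, rfl⟩ := (AFA.expEquiv A B).surjective φ
    obtain ⟨rfl, rfl⟩ := Hyperset.pair_inj h
    rw [AFA.ev_app]
    refine AFA.pair_mem_graph.2 ⟨a.2, ?_⟩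
    exact congrArg (fun φ => (φ a).1) ((AFA.expEquiv A B).symm_apply_apply ψ)
  · exact M.not_assumptionComplete ⟨_, rfl⟩ ⟨_, rfl⟩
  -- `Definable₁` treats a predicate as a set of tuples indexed by `Fin 1`, whence the variable `0`.
  · exact M.not_assumptionComplete (M.definable_sat_diag _ _ 0)
      (M.definable_sat_assumption_diag _ _ _ _ 0)
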